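/- Let $\mathbf H$ be the skew field of real quaternions, $n\ge 1$, and let $A=(a_{ij})$ be an $n\times n$ matrix over $\mathbf H$. For $\sigma\in S_n$ and an index $k$ whose $\sigma$-cycle has length $l$, put $$\pi_k(\sigma)=a_{k,\sigma(k)}\,a_{\sigma(k),\sigma^2(k)}\cdots a_{\sigma^{l-1}(k),k}.$$ For a fixed index $i$, write $\sigma$ as a product of $r=r(\sigma)$ disjoint cycles (fixed points included); let $k_1=i$, and let $k_2<\dots<k_r$ be the least elements of the cycles of $\sigma$ that do not contain $i$. The $i$-th row determinant and the $i$-th column determinant of $A$ are $$\operatorname{rdet}_i A=\sum_{\sigma\in S_n}(-1)^{n-r}\,\pi_{k_1}(\sigma)\,\pi_{k_2}(\sigma)\cdots\pi_{k_r}(\sigma),\qquad \operatorname{cdet}_i A=\sum_{\sigma\in S_n}(-1)^{n-r}\,\pi_{k_r}(\sigma)\cdots\pi_{k_2}(\sigma)\,\pi_{k_1}(\sigma).$$ For a column $y\in\mathbf H^{n\times 1}$ let $A_{.j}(y)$ be the matrix obtained from $A$ by replacing its $j$-th column with $y$. **Theorem (Cramer's rule for a Hermitian right system).** Let $A$ be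 Hermitian, i.e. $a_{ij}=\overline{a_{ji}}$ for all $i,j$. Then $\operatorname{rdet}_1A=\dots=\operatorname{rdet}_nA=\operatorname{cdet}_1A=\dots=\operatorname{cdet}_nA\in\mathbf R$, and this common value is denoted by $\det A$. If $\det A\neq 0$, then for every column $y=(y_1,\dots,y_n)^T$ over $\mathbf H$ the right system $A\cdot x=y$, i.e. $\sum_{j=1}^n a_{ij}x_j=y_i$ for $i=1,\dots,n$, has a unique solution $x=(x_1,\dots,x_n)^T$ over $\mathbf H$, and it is given by $$x_j=\frac{\operatorname{cdet}_j A_{.j}(y)}{\det A},\qquad j=1,\dots,n.$$ -/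

import Mathlib

/-- The indices which open the cycles of `σ` when it is written as a product of disjoint cycles:
first `i`, opening its own cycle, and then, in increasing order, the least element of every cycle
of `σ` (fixed points included) that does not contain `i`. -/
def cycleLeaders {n : ℕ} (i : Fin n) (σ : Equiv.Perm (Fin n)) : List (Fin n) :=
  i :: (List.finRange n).filter (fun k => ¬ σ.SameCycle i k ∧ ∀ m, σ.SameCycle k m → k ≤ m)

/-- The product `a_{k,σ(k)} * a_{σ(k),σ²(k)} * ⋯ * a_{σ⁻¹(k),k}`, in this order, of the entries of
`A` along the cycle of `σ` opened by `k`; the number of factors is the number of elements of that cycle. -/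
def cycleProd {R : Type*} [Ring R] {n : ℕ} (A : Matrix (Fin n) (Fin n) R)
    (σ : Equiv.Perm (Fin n)) (k : Fin n) : R :=
  ((List.range (Finset.univ.filter (fun m => σ.SameCycle k m)).card).map
    (fun m => A ((σ ^ m) k) ((σ ^ (m + 1)) k))).prod

/-- The `i`-th row determinant: the cycle products are multiplied from left to right, the cycle
of `i` being the leftmost. -/
def rowDet {R : Type*} [Ring R] {n : ℕ} (i : Fin n) (A : Matrix (Fin n) (Fin n) R) : R :=
  ∑ σ : Equiv.Perm (Fin n),
    ((Equiv.Perm.sign σ : ℤ) : R) * ((cycleLeaders i σ).map (cycleProd A σ)).prod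

/-- The `j`-th column determinant: the cycle products are multiplied from right to left, the cycle
of `j` being the rightmost. Read from right to left, the factors along the cycle of a leader `k`
are `a_{τ⁻¹(k),k}`, `a_{τ⁻²(k),τ⁻¹(k)}`, …, `a_{k,τ(k)}`, so that each single cycle
contributes the same product as in a row determinant. -/
def colDet {R : Type*} [Ring R] {n : ℕ} (j : Fin n) (A : Matrix (Fin n) (Fin n) R) : R :=
  ∑ τ : Equiv.Perm (Fin n),
    ((Equiv.Perm.sign τ : ℤ) : R) * ((cycleLeaders j τ).reverse.map (cycleProd A τ)).prod

/-- The determinant of a Hermitian matrix of size `n ≥ 1`, as its row determinant for the first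
index. For Hermitian quaternion matrices it is the common value of all row and all column
determinants; that fact is not built into the definition. -/
def hermitianDet {R : Type*} [Ring R] {n : ℕ} [NeZero n] (A : Matrix (Fin n) (Fin n) R) : R :=
  rowDet 0 A

/-!
Let `A` be a Hermitian quaternion matrix. Reversing the direction of one cycle of a permutation
changes neither its sign nor its cycle leaders, and it conjugates the product of entries of `A` along
that cycle (`cycleProd_reverseCycle_self`). Averaging over these reversals, one cycle at a time,
replaces each cycle product by its real part (`sum_mul_prod_eq_sum_mul_prod_re`). Real parts are
central, and the real part of a cycle product does not depend on the starting point of the cycle, so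
`rowDet i A` equals the real number `∑ σ, sign σ * ∏ Re (cycle products of σ)`, whatever `i` is
(`rowDet_eq_coe_sum_cycleReProd`). Since `star (rowDet i A) = colDet i Aᴴ`, the column
determinants have the same value.

Cramer's rule rests on the vanishing of `rowDet j B` when `B` arises from `A` by replacing row `j`
with row `k ≠ j` (`rowDet_eq_zero_of_row_eq`). The map `σ ↦ σ * swap j k` matches the permutations
that separate `j` and `k` with those that do not, and flips the sign. Let `p` and `c` be the products
along the separate cycles of `j` and `k`. The separating permutation contributes `p * Re c`,
the merged one contributes `c * p`, each times the same real factor. As the cycle of `k` avoids row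
`j`, the average of `c` over its two directions is `Re c`, and everything cancels. The row
determinant `rowDet j` is left linear in row `j`, hence replacing row `j` by the combination
`∑ k, w k • A k` gives `w j * det A`; conjugated, this reads
`colDet j (A.updateCol j (A x)) = x j * det A`. If `det A ≠ 0`, this formula determines `x`, so
`x ↦ A x` is injective, and it is surjective because `ℍⁿ` is finite-dimensional over `ℝ`.
-/

open Equiv Equiv.Perm

/-! ### Cycles of a permutation -/

section Cycles

variable {n : ℕ} {σ τ : Perm (Fin n)}

theorem card_sameCycle_eq_minimalPeriod (σ : Perm (Fin n)) (k : Fin n) :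
    (Finset.univ.filter (fun m => σ.SameCycle k m)).card = Function.minimalPeriod σ k := by
  -- the cycle of `k` is listed without repetition by the first `minimalPeriod σ k` iterates
  have himg : Finset.univ.filter (fun m => σ.SameCycle k m) =
      (Finset.range (Function.minimalPeriod σ k)).image (fun m => (σ ^ m) k) := by
    ext x
    simp only [Finset.mem_filter, Finset.mem_univ, true_and, Finset.mem_image, Finset.mem_range]
    constructor
    · intro h
      obtain ⟨m, rfl⟩ := h.exists_nat_pow_eq
      refine ⟨m % Function.minimalPeriod σ k, Nat.mod_lt _
        (Function.minimalPeriod_pos_of_mem_periodicPts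
        (Function.Injective.mem_periodicPts σ.injective k)), ?_⟩
      simp only [← Equiv.Perm.iterate_eq_pow, Function.iterate_mod_minimalPeriod_eq]
    · rintro ⟨m, -, rfl⟩
      exact ⟨m, by simp⟩
  rw [himg, Finset.card_image_of_injOn, Finset.card_range]
  intro a ha b hb hab
  simp only [← Equiv.Perm.iterate_eq_pow] at hab
  exact (Function.iterate_eq_iterate_iff_of_lt_minimalPeriod
    (by simpa using ha) (by simpa using hb)).1 hab

theorem cycleProd_eq_prod_range {R : Type*} [Ring R] (A : Matrix (Fin n) (Fin n) R)
    (σ : Perm (Fin n)) (k : Fin n) :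
    cycleProd A σ k = ((List.range (Function.minimalPeriod σ k)).map
      (fun m => A ((σ ^ m) k) ((σ ^ (m + 1)) k))).prod := by
  rw [cycleProd, card_sameCycle_eq_minimalPeriod]

theorem pow_minimalPeriod_apply (σ : Perm (Fin n)) (k : Fin n) :
    (σ ^ Function.minimalPeriod σ k) k = k := by
  rw [← Equiv.Perm.iterate_eq_pow, Function.iterate_minimalPeriod]

theorem sameCycle_pow_apply (σ : Perm (Fin n)) (k : Fin n) (m : ℕ) :
    σ.SameCycle k ((σ ^ m) k) := ⟨m, by simp⟩

theorem pow_apply_eq_of_agree {k : Fin n} (h : ∀ x, σ.SameCycle k x → τ x = σ x) (m : ℕ) :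
    (τ ^ m) k = (σ ^ m) k := by
  induction m with
  | zero => rfl
  | succ m ih =>
    rw [pow_succ', Perm.mul_apply, ih, h _ (sameCycle_pow_apply σ k m), pow_succ', Perm.mul_apply]

/-- A permutation that agrees with `σ` on the cycle of `k` has the same cycle through `k`. -/
theorem sameCycle_iff_of_agree {k : Fin n} (h : ∀ x, σ.SameCycle k x → τ x = σ x) (x : Fin n) :
    τ.SameCycle k x ↔ σ.SameCycle k x := by
  constructor
  · intro hx
    obtain ⟨m, rfl⟩ := hx.exists_nat_pow_eq
    rw [pow_apply_eq_of_agree h]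
    exact sameCycle_pow_apply σ k m
  · intro hx
    obtain ⟨m, rfl⟩ := hx.exists_nat_pow_eq
    rw [← pow_apply_eq_of_agree h]
    exact sameCycle_pow_apply τ k m

theorem cycleProd_congr {R : Type*} [Ring R] {A B : Matrix (Fin n) (Fin n) R} {k : Fin n}
    (h : ∀ x, σ.SameCycle k x → τ x = σ x)
    (hAB : ∀ x y, σ.SameCycle k x → σ.SameCycle k y → B x y = A x y) :
    cycleProd B τ k = cycleProd A σ k := by
  simp only [cycleProd, sameCycle_iff_of_agree h, pow_apply_eq_of_agree h]
  congr 1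
  refine List.map_congr_left fun m _ => ?_
  exact hAB _ _ (sameCycle_pow_apply σ k m) (sameCycle_pow_apply σ k (m + 1))

theorem star_prod_map_range {R : Type*} [Ring R] [StarRing R] (f : ℕ → R) (l : ℕ) :
    star ((List.range l).map f).prod =
      ((List.range l).map (fun m => star (f (l - 1 - m)))).prod := by
  induction l generalizing f with
  | zero => simp
  | succ l ih =>
    rw [List.prod_range_succ, star_mul, ih, List.prod_range_succ']
    congr 1
    congr 1
    refine List.map_congr_left fun m hm => ?_
    congr 2
    omega

theorem minimalPeriod_inv (σ : Perm (Fin n)) (k : Fin n) :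
    Function.minimalPeriod (σ⁻¹ : Perm (Fin n)) k = Function.minimalPeriod σ k := by
  simp only [← card_sameCycle_eq_minimalPeriod, sameCycle_inv]

/-- Conjugation reverses the order of the factors, so it turns the product along a cycle into the
product along the reversed cycle. -/
theorem star_cycleProd {R : Type*} [Ring R] [StarRing R] (A : Matrix (Fin n) (Fin n) R)
    (σ : Perm (Fin n)) (k : Fin n) :
    star (cycleProd A σ k) = cycleProd A.conjTranspose σ⁻¹ k := by
  rw [cycleProd_eq_prod_range, cycleProd_eq_prod_range, star_prod_map_range, minimalPeriod_inv]
  congr 1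
  refine List.map_congr_left fun m hm => ?_
  have hm : m < Function.minimalPeriod σ k := by simpa using hm
  have key : ∀ a b : ℕ, a + b = Function.minimalPeriod σ k → (σ ^ a) k = (σ⁻¹ ^ b) k := by
    intro a b hab
    rw [inv_pow, Perm.eq_inv_iff_eq, ← Perm.mul_apply, ← pow_add, add_comm, hab,
      pow_minimalPeriod_apply]
  rw [Matrix.conjTranspose_apply, key _ (m + 1) (by omega), key _ m (by omega)]

/-- The permutation obtained from `σ` by reversing the cycle through `k`. -/
def reverseCycle (σ : Perm (Fin n)) (k : Fin n) : Perm (Fin n) :=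
  σ * (σ.cycleOf k)⁻¹ * (σ.cycleOf k)⁻¹

theorem reverseCycle_apply_of_sameCycle {k x : Fin n} (h : σ.SameCycle k x) :
    reverseCycle σ k x = σ⁻¹ x := by
  simp [reverseCycle, cycleOf_inv, cycleOf_apply, h]

theorem reverseCycle_apply_of_not_sameCycle {k x : Fin n} (h : ¬ σ.SameCycle k x) :
    reverseCycle σ k x = σ x := by
  simp [reverseCycle, cycleOf_inv, cycleOf_apply, h]

theorem sameCycle_reverseCycle (k a b : Fin n) :
    (reverseCycle σ k).SameCycle a b ↔ σ.SameCycle a b := by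
  by_cases h : σ.SameCycle k a
  · rw [← sameCycle_inv (f := σ)]
    exact sameCycle_iff_of_agree
      (fun x hx => reverseCycle_apply_of_sameCycle (h.trans (sameCycle_inv.1 hx))) b
  · exact sameCycle_iff_of_agree
      (fun x hx => reverseCycle_apply_of_not_sameCycle fun h' => h (h'.trans hx.symm)) b

theorem reverseCycle_reverseCycle (σ : Perm (Fin n)) (k : Fin n) :
    reverseCycle (reverseCycle σ k) k = σ := by
  ext1 x
  by_cases h : σ.SameCycle k x
  · rw [reverseCycle_apply_of_sameCycle ((sameCycle_reverseCycle k k x).2 h), Perm.inv_eq_iff_eq,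
      reverseCycle_apply_of_sameCycle (sameCycle_apply_right.2 h), ← Perm.mul_apply,
      inv_mul_cancel, Perm.one_apply]
  · rw [reverseCycle_apply_of_not_sameCycle (fun h' => h ((sameCycle_reverseCycle k k x).1 h')),
      reverseCycle_apply_of_not_sameCycle h]

theorem sign_reverseCycle (σ : Perm (Fin n)) (k : Fin n) :
    sign (reverseCycle σ k) = sign σ := by
  rw [reverseCycle, Perm.sign_mul, Perm.sign_mul, mul_assoc, Int.units_mul_self, mul_one]

theorem cycleProd_reverseCycle_of_not_sameCycle {R : Type*} [Ring R]
    (A : Matrix (Fin n) (Fin n) R) {k m : Fin n} (h : ¬ σ.SameCycle k m) :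
    cycleProd A (reverseCycle σ k) m = cycleProd A σ m :=
  cycleProd_congr (fun _ hx => reverseCycle_apply_of_not_sameCycle fun h' => h (h'.trans hx.symm))
    fun _ _ _ _ => rfl

theorem cycleProd_reverseCycle_self {R : Type*} [Ring R] [StarRing R]
    {A : Matrix (Fin n) (Fin n) R} {k : Fin n}
    (hA : ∀ x y, σ.SameCycle k x → σ.SameCycle k y → A x y = star (A y x)) :
    cycleProd A (reverseCycle σ k) k = star (cycleProd A σ k) := by
  rw [star_cycleProd]
  exact cycleProd_congr (fun x hx => reverseCycle_apply_of_sameCycle (sameCycle_inv.1 hx))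
    fun x y hx hy => hA x y (sameCycle_inv.1 hx) (sameCycle_inv.1 hy)

theorem prod_map_cycleLeaders {R : Type*} [Monoid R] (i : Fin n) (σ : Perm (Fin n))
    (f : Fin n → R) :
    ((cycleLeaders i σ).map f).prod = f i * ((List.finRange n).map (fun k =>
      if ¬ σ.SameCycle i k ∧ ∀ m, σ.SameCycle k m → k ≤ m then f k else 1)).prod := by
  rw [cycleLeaders, List.map_cons, List.prod_cons]
  congr 1
  induction List.finRange n with
  | nil => simp
  | cons a l ih =>
    rw [List.filter_cons, List.map_cons, List.prod_cons, ← ih]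
    split_ifs <;> simp_all

theorem cycleLeaders_inv (i : Fin n) (σ : Perm (Fin n)) :
    cycleLeaders i σ⁻¹ = cycleLeaders i σ := by
  simp only [cycleLeaders, sameCycle_inv]

/-- Conjugation exchanges row and column determinants. -/
theorem star_rowDet {R : Type*} [Ring R] [StarRing R] (i : Fin n)
    (A : Matrix (Fin n) (Fin n) R) :
    star (rowDet i A) = colDet i A.conjTranspose := by
  rw [rowDet, colDet, star_sum, ← Equiv.sum_comp (Equiv.inv (Perm (Fin n)))]
  refine Finset.sum_congr rfl fun σ _ => ?_
  have hcomm : ∀ (z : ℤ) (r : R), star ((z : R) * r) = (z : R) * star r := by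
    intro z r
    rw [star_mul, star_intCast, (Int.cast_commute z (star r)).eq]
  rw [hcomm, Equiv.inv_apply, sign_inv, cycleLeaders_inv]
  congr 1
  induction cycleLeaders i σ with
  | nil => simp
  | cons a l ih =>
    rw [List.map_cons, List.prod_cons, star_mul, ih, List.reverse_cons, List.map_append,
      List.prod_append, star_cycleProd, inv_inv]
    simp

end Cycles

/-! ### Averaging over reversals -/

section Averaging

/-- An involution that conjugates one factor and fixes the others turns that factor into its real
part. -/
theorem sum_mul_eq_sum_re_mul {X : Type*} [Fintype X] {φ : X → X}
    (hφ : Function.Involutive φ) {g u v : X → Quaternion ℝ}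
    (hg : ∀ x, g (φ x) = g x) (hv : ∀ x, v (φ x) = v x) (hu : ∀ x, u (φ x) = star (u x)) :
    ∑ x, g x * u x * v x = ∑ x, g x * ((u x).re : Quaternion ℝ) * v x := by
  have h1 : ∑ x, g x * u x * v x = ∑ x, g x * star (u x) * v x := by
    rw [← Equiv.sum_comp hφ.toPerm]
    refine Finset.sum_congr rfl fun x _ => ?_
    simp [hg, hv, hu]
  have h2 : (2 : ℝ) • ∑ x, g x * u x * v x =
      (2 : ℝ) • ∑ x, g x * ((u x).re : Quaternion ℝ) * v x := by
    rw [two_smul, two_smul]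
    nth_rewrite 2 [h1]
    rw [← Finset.sum_add_distrib, ← Finset.sum_add_distrib]
    refine Finset.sum_congr rfl fun x _ => ?_
    rw [← add_mul, ← mul_add, Quaternion.self_add_star, two_mul, mul_add, add_mul]
  exact smul_right_injective _ (two_ne_zero' ℝ) h2

/-- Averaging over one involution per factor: if `φ k` conjugates the `k`-th factor and fixes the
other ones, every factor may be replaced by its real part. -/
theorem sum_mul_prod_eq_sum_mul_prod_re {X ι : Type*} [Fintype X] {φ : ι → X → X}
    (hφ : ∀ k, Function.Involutive (φ k)) {h : ι → X → Quaternion ℝ}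
    (hself : ∀ k x, h k (φ k x) = star (h k x))
    (hne : ∀ k m, m ≠ k → ∀ x, h m (φ k x) = h m x)
    (l : List ι) (hl : l.Nodup) (g : X → Quaternion ℝ) (hg : ∀ k x, g (φ k x) = g x) :
    ∑ x, g x * (l.map (fun k => h k x)).prod =
      ∑ x, g x * (((l.map (fun k => (h k x).re)).prod : ℝ) : Quaternion ℝ) := by
  induction l generalizing g with
  | nil => simp
  | cons a l ih =>
    have hmem : ∀ m ∈ l, m ≠ a := fun m hm hma => (List.nodup_cons.1 hl).1 (hma ▸ hm)
    have key := sum_mul_eq_sum_re_mul (hφ a) (g := g) (u := h a)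
      (v := fun x => (l.map (fun k => h k x)).prod) (hg a)
      (fun x => by
        congr 1
        exact List.map_congr_left fun m hm => hne a m (hmem m hm) x) (hself a)
    simp only [List.map_cons, List.prod_cons, ← mul_assoc]
    rw [key, ih (List.nodup_cons.1 hl).2 (fun x => g x * ((h a x).re : Quaternion ℝ))]
    · refine Finset.sum_congr rfl fun x _ => ?_
      rw [Quaternion.coe_mul, mul_assoc]
    · intro k x
      rw [hg]
      by_cases hk : a = k
      · subst hk
        rw [hself, Quaternion.re_star]
      · rw [hne k a hk]

end Averaging

/-! ### Row determinants as signed sums of products of real parts -/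

section RealParts

variable {n : ℕ} {σ τ : Perm (Fin n)}

/-- The product of the real parts of the cycle products of `σ`, over those cycles whose elements
satisfy `p`; each such cycle is represented by its least element. It is meant for predicates `p`
that are constant on the cycles of `σ`. -/
def cycleReProd (A : Matrix (Fin n) (Fin n) (Quaternion ℝ)) (σ : Perm (Fin n))
    (p : Fin n → Prop) [DecidablePred p] : ℝ :=
  ∏ k, if p k ∧ ∀ m, σ.SameCycle k m → k ≤ m then (cycleProd A σ k).re else 1

/-- Cyclic rotation of the factors does not change the real part, as `Re (a * b) = Re (b * a)`. -/
theorem re_cycleProd_apply (A : Matrix (Fin n) (Fin n) (Quaternion ℝ)) (σ : Perm (Fin n))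
    (k : Fin n) : (cycleProd A σ (σ k)).re = (cycleProd A σ k).re := by
  have hper : Function.minimalPeriod σ (σ k) = Function.minimalPeriod σ k := by
    simp only [← card_sameCycle_eq_minimalPeriod, sameCycle_apply_left]
  have hpos : 0 < Function.minimalPeriod σ k :=
    Function.minimalPeriod_pos_of_mem_periodicPts
      (Function.Injective.mem_periodicPts σ.injective k)
  rw [cycleProd_eq_prod_range, cycleProd_eq_prod_range, hper]
  obtain ⟨l, hl⟩ := Nat.exists_eq_succ_of_ne_zero hpos.ne'
  have hk : (σ ^ (l + 1)) k = k := by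
    rw [← Nat.succ_eq_add_one, ← hl, pow_minimalPeriod_apply]
  have hs : ∀ m, (σ ^ m) (σ k) = (σ ^ (m + 1)) k := fun m => by rw [pow_succ, Perm.mul_apply]
  have hcomm : ∀ a b : Quaternion ℝ, (a * b).re = (b * a).re := fun a b => by
    simp only [Quaternion.re_mul]; ring
  simp only [hl, hs]
  rw [List.prod_range_succ, List.prod_range_succ', hcomm]
  simp only [Nat.succ_eq_add_one, pow_succ' σ (l + 1), Perm.mul_apply, hk, pow_zero, zero_add,
    pow_one, Perm.one_apply]

theorem re_cycleProd_eq_of_sameCycle (A : Matrix (Fin n) (Fin n) (Quaternion ℝ))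
    {k m : Fin n} (h : σ.SameCycle k m) : (cycleProd A σ m).re = (cycleProd A σ k).re := by
  obtain ⟨a, rfl⟩ := h.exists_nat_pow_eq
  induction a with
  | zero => rfl
  | succ a ih =>
    rw [pow_succ', Perm.mul_apply, re_cycleProd_apply, ih (sameCycle_pow_apply σ k a)]

/-- The factor of the cycle through `k` splits off; any element `k` of the cycle may stand for its
least element. -/
theorem cycleReProd_eq_re_mul (A : Matrix (Fin n) (Fin n) (Quaternion ℝ)) (σ : Perm (Fin n))
    {p : Fin n → Prop} [DecidablePred p] (hp : ∀ a b, σ.SameCycle a b → p a → p b)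
    {k : Fin n} (hk : p k) :
    cycleReProd A σ p =
      (cycleProd A σ k).re * cycleReProd A σ (fun m => p m ∧ ¬ σ.SameCycle k m) := by
  obtain ⟨m₀, hm₀, hmin⟩ := (Finset.univ.filter (fun m => σ.SameCycle k m)).exists_min_image id
    ⟨k, Finset.mem_filter.2 ⟨Finset.mem_univ k, SameCycle.refl σ k⟩⟩
  simp only [Finset.mem_filter, Finset.mem_univ, true_and, id] at hm₀ hmin
  rw [cycleReProd, cycleReProd, ← Finset.mul_prod_erase _ _ (Finset.mem_univ m₀),
    ← Finset.mul_prod_erase (a := m₀)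
      (f := fun m => if (p m ∧ ¬ σ.SameCycle k m) ∧ _ then _ else _) _ (Finset.mem_univ m₀),
    if_pos ⟨hp _ _ hm₀ hk, fun m hm => hmin m (hm₀.trans hm)⟩, if_neg (by simp [hm₀]), one_mul,
    re_cycleProd_eq_of_sameCycle A hm₀]
  congr 1
  refine Finset.prod_congr rfl fun m hm => ?_
  congr 1
  refine propext ⟨fun h => ⟨⟨h.1, fun hkm => ?_⟩, h.2⟩, fun h => ⟨h.1.1, h.2⟩⟩
  exact (Finset.ne_of_mem_erase hm) (le_antisymm (h.2 _ (hkm.symm.trans hm₀)) (hmin m hkm))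

theorem cycleReProd_congr {A : Matrix (Fin n) (Fin n) (Quaternion ℝ)} {p q : Fin n → Prop}
    [DecidablePred p] [DecidablePred q] (hpq : ∀ k, q k ↔ p k)
    (hsc : ∀ k m, p k → (τ.SameCycle k m ↔ σ.SameCycle k m))
    (hre : ∀ k, p k → (cycleProd A τ k).re = (cycleProd A σ k).re) :
    cycleReProd A τ q = cycleReProd A σ p := by
  refine Finset.prod_congr rfl fun k _ => ?_
  by_cases hk : p k
  · simp only [hpq, hk, hsc k _ hk, hre k hk]
  · simp [hpq, hk]

/-- If `A` is Hermitian away from the row and the column `i`, then in `rowDet i A` every cycle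
product other than the first may be replaced by its real part. -/
theorem rowDet_eq_sum_mul_cycleReProd {A : Matrix (Fin n) (Fin n) (Quaternion ℝ)} (i : Fin n)
    (hA : ∀ x y, x ≠ i → y ≠ i → A x y = star (A y x)) :
    rowDet i A = ∑ σ : Perm (Fin n), ((sign σ : ℤ) : Quaternion ℝ) * cycleProd A σ i *
      (cycleReProd A σ (fun k => ¬ σ.SameCycle i k) : Quaternion ℝ) := by
  -- one involution for each index `k`: it reverses the cycle led by `k`, and is trivial unless `k`
  -- leads a cycle
  set φ : Fin n → Perm (Fin n) → Perm (Fin n) := fun k σ =>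
    if ¬ σ.SameCycle i k ∧ ∀ m, σ.SameCycle k m → k ≤ m then reverseCycle σ k else σ
  have hφ_pos : ∀ k σ, (¬ σ.SameCycle i k ∧ ∀ m, σ.SameCycle k m → k ≤ m) →
      φ k σ = reverseCycle σ k := fun k σ h => if_pos h
  have hφ_neg : ∀ k σ, ¬ (¬ σ.SameCycle i k ∧ ∀ m, σ.SameCycle k m → k ≤ m) →
      φ k σ = σ := fun k σ h => if_neg h
  have hsc : ∀ k σ a b, (φ k σ).SameCycle a b ↔ σ.SameCycle a b := by
    intro k σ a b
    by_cases h : ¬ σ.SameCycle i k ∧ ∀ m, σ.SameCycle k m → k ≤ m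
    · rw [hφ_pos k σ h, sameCycle_reverseCycle]
    · rw [hφ_neg k σ h]
  have hφ : ∀ k, Function.Involutive (φ k) := by
    intro k σ
    by_cases h : ¬ σ.SameCycle i k ∧ ∀ m, σ.SameCycle k m → k ≤ m
    · rw [hφ_pos k (φ k σ) (by simpa only [hsc] using h), hφ_pos k σ h,
        reverseCycle_reverseCycle]
    · rw [hφ_neg k σ h, hφ_neg k σ h]
  have key := sum_mul_prod_eq_sum_mul_prod_re hφ
    (h := fun k σ => if ¬ σ.SameCycle i k ∧ ∀ m, σ.SameCycle k m → k ≤ m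
      then cycleProd A σ k else 1) ?_ ?_ (List.finRange n) (List.nodup_finRange n)
    (fun σ => ((sign σ : ℤ) : Quaternion ℝ) * cycleProd A σ i) ?_
  · simp only [rowDet, prod_map_cycleLeaders, ← mul_assoc]
    rw [key]
    refine Finset.sum_congr rfl fun σ _ => ?_
    congr 2
    rw [cycleReProd, ← List.ofFn_eq_map, List.prod_ofFn]
    exact Finset.prod_congr rfl fun k _ => by split_ifs <;> rfl
  · intro k σ
    by_cases h : ¬ σ.SameCycle i k ∧ ∀ m, σ.SameCycle k m → k ≤ m
    · rw [if_pos (by simpa only [hsc] using h), if_pos h, hφ_pos k σ h]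
      refine cycleProd_reverseCycle_self fun x y hx hy => hA x y ?_ ?_
      · rintro rfl; exact h.1 hx.symm
      · rintro rfl; exact h.1 hy.symm
    · rw [hφ_neg k σ h, if_neg h, star_one]
  · intro k m hmk σ
    simp only [hsc]
    by_cases h : ¬ σ.SameCycle i k ∧ ∀ m, σ.SameCycle k m → k ≤ m
    · rw [hφ_pos k σ h]
      by_cases h' : ¬ σ.SameCycle i m ∧ ∀ k, σ.SameCycle m k → m ≤ k
      · rw [if_pos h', if_pos h', cycleProd_reverseCycle_of_not_sameCycle]
        exact fun hkm => hmk (le_antisymm (h'.2 _ hkm.symm) (h.2 _ hkm))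
      · rw [if_neg h', if_neg h']
    · rw [hφ_neg k σ h]
  · intro k σ
    by_cases h : ¬ σ.SameCycle i k ∧ ∀ m, σ.SameCycle k m → k ≤ m
    · rw [hφ_pos k σ h, sign_reverseCycle,
        cycleProd_reverseCycle_of_not_sameCycle _ (fun h' => h.1 h'.symm)]
    · rw [hφ_neg k σ h]

/-- The row determinants of a Hermitian matrix do not depend on `i`: each is the signed sum over all
permutations of the products of the real parts of their cycle products. -/
theorem rowDet_eq_coe_sum_cycleReProd {A : Matrix (Fin n) (Fin n) (Quaternion ℝ)}
    (hA : A.IsHermitian) (i : Fin n) :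
    rowDet i A = ((∑ σ : Perm (Fin n), ((sign σ : ℤ) : ℝ) *
      cycleReProd A σ (fun _ => True) : ℝ) : Quaternion ℝ) := by
  have hA' : ∀ x y, A x y = star (A y x) := fun x y => (hA.apply x y).symm
  rw [rowDet_eq_sum_mul_cycleReProd i fun x y _ _ => hA' x y,
    sum_mul_eq_sum_re_mul (φ := fun σ => reverseCycle σ i)
      (fun σ => reverseCycle_reverseCycle σ i) (fun σ => by rw [sign_reverseCycle])
      (fun σ => ?_) (fun σ => cycleProd_reverseCycle_self fun x y _ _ => hA' x y)]
  · rw [Quaternion.algebraMap_def.symm, map_sum]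
    simp only [Quaternion.algebraMap_def]
    refine Finset.sum_congr rfl fun σ _ => ?_
    rw [cycleReProd_eq_re_mul A σ (p := fun _ => True) (fun _ _ _ h => h) (k := i) trivial]
    simp only [true_and]
    push_cast
    rw [mul_assoc]
  · congr 1
    refine cycleReProd_congr (fun k => by rw [sameCycle_reverseCycle])
      (fun k m _ => sameCycle_reverseCycle i k m) fun k hk => ?_
    rw [cycleProd_reverseCycle_of_not_sameCycle _ hk]

end RealParts

/-! ### Merging two cycles, and matrices with two equal rows -/

section EqualRows

variable {n : ℕ} {σ : Perm (Fin n)}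

/-- Starting from `j`, the permutation `σ * swap j k` first runs through the cycle of `k` under
`σ`. -/
theorem pow_mul_swap_apply {j k : Fin n} (h : ¬ σ.SameCycle j k) {m : ℕ} (hm : 1 ≤ m)
    (hmk : m ≤ Function.minimalPeriod σ k) : ((σ * swap j k) ^ m) j = (σ ^ m) k := by
  induction m, hm using Nat.le_induction with
  | base => simp
  | succ m hm ih =>
    have hj : (σ ^ m) k ≠ j := fun h' => h (h' ▸ sameCycle_pow_apply σ k m).symm
    have hk : (σ ^ m) k ≠ k := fun h' => by
      have := Function.IsPeriodicPt.minimalPeriod_le (f := σ) (x := k) (n := m) hm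
        (by rwa [← Equiv.Perm.iterate_eq_pow] at h')
      omega
    rw [pow_succ', Perm.mul_apply, ih (by omega), Perm.mul_apply, swap_apply_of_ne_of_ne hj hk,
      pow_succ', Perm.mul_apply]

theorem sameCycle_mul_swap {j k : Fin n} (h : ¬ σ.SameCycle j k) :
    (σ * swap j k).SameCycle j k := by
  have hpos : 0 < Function.minimalPeriod σ k :=
    Function.minimalPeriod_pos_of_mem_periodicPts
      (Function.Injective.mem_periodicPts σ.injective k)
  have := sameCycle_pow_apply (σ * swap j k) j (Function.minimalPeriod σ k)
  rwa [pow_mul_swap_apply h hpos le_rfl, pow_minimalPeriod_apply] at this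

theorem not_sameCycle_mul_swap {j k : Fin n} (hjk : j ≠ k) (h : σ.SameCycle j k) :
    ¬ (σ * swap j k).SameCycle j k := by
  classical
  have hex : ∃ a : ℕ, 0 < a ∧ (σ ^ a) j = k := by
    obtain ⟨a, ha⟩ := h.exists_nat_pow_eq
    refine ⟨a, Nat.pos_of_ne_zero ?_, ha⟩
    rintro rfl
    exact hjk ha
  obtain ⟨hapos, ha⟩ := Nat.find_spec hex
  set a := Nat.find hex
  have hmin : ∀ m, 0 < m → m < a → (σ ^ m) j ≠ k := fun m h0 hm h' =>
    Nat.find_min hex hm ⟨h0, h'⟩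
  have hj : ∀ m, 0 < m → m ≤ a → (σ ^ m) j ≠ j := by
    intro m h0 hm h'
    rcases hm.eq_or_lt with rfl | hlt
    · exact hjk (h'.symm.trans ha)
    · refine hmin (a - m) (by omega) (by omega) ?_
      rw [← ha]
      nth_rewrite 1 [← h']
      rw [← Perm.mul_apply, ← pow_add, Nat.sub_add_cancel hm]
  -- the arc of the cycle of `σ` that leads from `σ j` to `k` is a union of cycles of the product
  have hclosed : ∀ b : ℕ, ∃ m, 0 < m ∧ m ≤ a ∧ ((σ * swap j k) ^ b) k = (σ ^ m) j := by
    intro b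
    induction b with
    | zero => exact ⟨a, hapos, le_rfl, by simp [ha]⟩
    | succ b ih =>
      obtain ⟨m, h0, hm, hb⟩ := ih
      rcases hm.eq_or_lt with rfl | hlt
      · exact ⟨1, one_pos, hapos, by rw [pow_succ', Perm.mul_apply, hb, ha]; simp⟩
      · refine ⟨m + 1, by omega, hlt, ?_⟩
        rw [pow_succ', Perm.mul_apply, hb, Perm.mul_apply,
          swap_apply_of_ne_of_ne (hj m h0 hm) (hmin m h0 hlt), pow_succ' σ, Perm.mul_apply]
  intro hsc
  obtain ⟨b, hb⟩ := hsc.symm.exists_nat_pow_eq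
  obtain ⟨m, h0, hm, hb'⟩ := hclosed b
  exact hj m h0 hm (hb'.symm.trans hb)

theorem sameCycle_mul_swap_iff {j k : Fin n} (h : ¬ σ.SameCycle j k) (x : Fin n) :
    (σ * swap j k).SameCycle j x ↔ σ.SameCycle j x ∨ σ.SameCycle k x := by
  set τ := σ * swap j k with hτ
  have hτj : τ j = σ k := by simp [hτ]
  have hτk : τ k = σ j := by simp [hτ]
  have hτx : ∀ y, y ≠ j → y ≠ k → τ y = σ y := fun y h1 h2 => by
    rw [hτ, Perm.mul_apply, swap_apply_of_ne_of_ne h1 h2]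
  have hjk : τ.SameCycle j k := sameCycle_mul_swap h
  constructor
  · intro hx
    obtain ⟨m, rfl⟩ := hx.exists_nat_pow_eq
    clear hx
    induction m with
    | zero => exact Or.inl (SameCycle.refl σ j)
    | succ m ih =>
      rw [pow_succ', Perm.mul_apply]
      by_cases h1 : (τ ^ m) j = j
      · rw [h1, hτj]; exact Or.inr (sameCycle_apply_right.2 (SameCycle.refl σ k))
      by_cases h2 : (τ ^ m) j = k
      · rw [h2, hτk]; exact Or.inl (sameCycle_apply_right.2 (SameCycle.refl σ j))
      rw [hτx _ h1 h2, sameCycle_apply_right, sameCycle_apply_right]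
      exact ih
  · have hstep : ∀ y, τ.SameCycle j y → τ.SameCycle j (σ y) := by
      intro y hy
      by_cases h1 : y = j
      · rw [h1, ← hτk]; exact sameCycle_apply_right.2 hjk
      by_cases h2 : y = k
      · rw [h2, ← hτj]; exact sameCycle_apply_right.2 (SameCycle.refl τ j)
      rw [← hτx y h1 h2]
      exact sameCycle_apply_right.2 hy
    have hpow : ∀ y, τ.SameCycle j y → ∀ m : ℕ, τ.SameCycle j ((σ ^ m) y) := by
      intro y hy m
      induction m with
      | zero => exact hy
      | succ m ih =>
        rw [pow_succ', Perm.mul_apply]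
        exact hstep _ ih
    rintro (hx | hx)
    · obtain ⟨m, rfl⟩ := hx.exists_nat_pow_eq
      exact hpow j (SameCycle.refl τ j) m
    · obtain ⟨m, rfl⟩ := hx.exists_nat_pow_eq
      exact hpow k hjk m

theorem minimalPeriod_mul_swap {j k : Fin n} (h : ¬ σ.SameCycle j k) :
    Function.minimalPeriod (σ * swap j k : Perm (Fin n)) j =
      Function.minimalPeriod σ k + Function.minimalPeriod σ j := by
  simp only [← card_sameCycle_eq_minimalPeriod, sameCycle_mul_swap_iff h]
  rw [Finset.filter_or, Finset.card_union_of_disjoint, add_comm]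
  rw [Finset.disjoint_filter]
  exact fun x _ h1 h2 => h (h1.trans h2.symm)

/-- Multiplying by `swap j k` merges the cycles of `j` and `k`. If the rows `j` and `k` of `B`
agree, the product along the merged cycle is the product of the two separate ones. -/
theorem cycleProd_mul_swap {R : Type*} [Ring R] {B : Matrix (Fin n) (Fin n) R} {j k : Fin n}
    (h : ¬ σ.SameCycle j k) (hB : B j = B k) :
    cycleProd B (σ * swap j k) j = cycleProd B σ k * cycleProd B σ j := by
  have hk : ((σ * swap j k) ^ Function.minimalPeriod σ k) j = k := by
    rw [pow_mul_swap_apply h (Function.minimalPeriod_pos_of_mem_periodicPts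
      (Function.Injective.mem_periodicPts σ.injective k)) le_rfl, pow_minimalPeriod_apply]
  have h' : ¬ σ.SameCycle k j := fun h' => h h'.symm
  rw [cycleProd_eq_prod_range, cycleProd_eq_prod_range, cycleProd_eq_prod_range,
    minimalPeriod_mul_swap h, List.range_add, List.map_append, List.prod_append, List.map_map]
  congr 2
  · refine List.map_congr_left fun m hm => ?_
    have hm : m < Function.minimalPeriod σ k := by simpa using hm
    rw [pow_mul_swap_apply h (by omega) (Nat.succ_le_of_lt hm)]
    rcases Nat.eq_zero_or_pos m with rfl | h0
    · exact congrFun hB _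
    · rw [pow_mul_swap_apply h h0 hm.le]
  · refine List.map_congr_left fun m hm => ?_
    have hm : m < Function.minimalPeriod σ j := by simpa using hm
    rw [Function.comp_apply, add_assoc, add_comm _ m, add_comm _ (m + 1), pow_add, pow_add,
      Perm.mul_apply, Perm.mul_apply, hk, swap_comm,
      pow_mul_swap_apply h' (by omega) (Nat.succ_le_of_lt hm)]
    rcases Nat.eq_zero_or_pos m with rfl | h0
    · exact (congrFun hB _).symm
    · rw [pow_mul_swap_apply h' h0 hm.le]

/-- Merging the cycles of `j` and `k` turns the summand `p * Re c` into `- c * p`, where `p` and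
`c` are the products along the cycles of `j` and `k`; averaged over the two orientations of the
cycle of `k`, these cancel. -/
theorem rowDet_eq_zero_of_row_eq {B : Matrix (Fin n) (Fin n) (Quaternion ℝ)} {j k : Fin n}
    (hB : ∀ x y, x ≠ j → y ≠ j → B x y = star (B y x)) (hjk : j ≠ k) (hrow : B j = B k) :
    rowDet j B = 0 := by
  rw [rowDet_eq_sum_mul_cycleReProd j hB]
  -- split according to whether `j` and `k` lie on one cycle
  rw [← Finset.sum_filter_add_sum_filter_not Finset.univ (fun σ : Perm (Fin n) => σ.SameCycle j k)]
  set T : Perm (Fin n) → ℝ := fun σ =>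
    cycleReProd B σ (fun m => ¬ σ.SameCycle j m ∧ ¬ σ.SameCycle k m) with hT
  have hmerge : ∑ σ : Perm (Fin n) with σ.SameCycle j k,
      ((sign σ : ℤ) : Quaternion ℝ) * cycleProd B σ j *
        (cycleReProd B σ (fun m => ¬ σ.SameCycle j m) : Quaternion ℝ) =
      ∑ σ : Perm (Fin n) with ¬ σ.SameCycle j k,
        -(((sign σ : ℤ) : Quaternion ℝ) * cycleProd B σ k *
          (cycleProd B σ j * (T σ : Quaternion ℝ))) := by
    refine Finset.sum_nbij' (fun σ => σ * swap j k) (fun σ => σ * swap j k) ?_ ?_ ?_ ?_ ?_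
    · intro σ hσ
      simpa using not_sameCycle_mul_swap hjk (by simpa using hσ)
    · intro σ hσ
      simpa using sameCycle_mul_swap (by simpa using hσ)
    · intro σ _
      simp [mul_assoc]
    · intro σ _
      simp [mul_assoc]
    · intro τ hτ
      obtain ⟨σ, rfl⟩ : ∃ σ, τ = σ * swap j k := ⟨τ * swap j k, by simp [mul_assoc]⟩
      have hσ : ¬ σ.SameCycle j k := by
        have := not_sameCycle_mul_swap hjk (by simpa using hτ)
        simpa [mul_assoc] using this
      have hagree : ∀ m, ¬ σ.SameCycle j m ∧ ¬ σ.SameCycle k m →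
          ∀ x, σ.SameCycle m x → (σ * swap j k) x = σ x := by
        intro m hm x hx
        rw [Perm.mul_apply, swap_apply_of_ne_of_ne]
        · rintro rfl; exact hm.1 hx.symm
        · rintro rfl; exact hm.2 hx.symm
      have hT' : cycleReProd B (σ * swap j k) (fun m => ¬ (σ * swap j k).SameCycle j m) = T σ := by
        refine cycleReProd_congr (fun m => ?_)
          (fun m x hm => sameCycle_iff_of_agree (hagree m hm) x) fun m hm => ?_
        · rw [sameCycle_mul_swap_iff hσ, not_or]
        · rw [cycleProd_congr (hagree m hm) fun _ _ _ _ => rfl]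
      rw [hT', cycleProd_mul_swap hσ hrow, mul_assoc σ, swap_mul_self, mul_one, Perm.sign_mul,
        sign_swap hjk]
      push_cast
      simp only [mul_assoc, mul_neg, neg_mul, mul_one]
  have hsplit : ∑ σ : Perm (Fin n) with ¬ σ.SameCycle j k,
      ((sign σ : ℤ) : Quaternion ℝ) * cycleProd B σ j *
        (cycleReProd B σ (fun m => ¬ σ.SameCycle j m) : Quaternion ℝ) =
      ∑ σ : Perm (Fin n) with ¬ σ.SameCycle j k,
        ((sign σ : ℤ) : Quaternion ℝ) * ((cycleProd B σ k).re : Quaternion ℝ) *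
          (cycleProd B σ j * (T σ : Quaternion ℝ)) := by
    refine Finset.sum_congr rfl fun σ hσ => ?_
    have hσ : ¬ σ.SameCycle j k := by simpa using hσ
    rw [cycleReProd_eq_re_mul B σ (p := fun m => ¬ σ.SameCycle j m)
      (fun a b hab ha hb => ha (hb.trans hab.symm)) hσ, Quaternion.coe_mul, mul_assoc, mul_assoc]
    congr 1
    rw [← mul_assoc, ← mul_assoc, Quaternion.coe_commutes]
  -- `u` and `v` are cut off where `j` and `k` share a cycle: reversal conjugates the product along
  -- the cycle of `k` only if that cycle avoids the row `j`
  have havg := sum_mul_eq_sum_re_mul (φ := fun σ : Perm (Fin n) => reverseCycle σ k)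
    (fun σ => reverseCycle_reverseCycle σ k)
    (g := fun σ => ((sign σ : ℤ) : Quaternion ℝ))
    (u := fun σ => if ¬ σ.SameCycle j k then cycleProd B σ k else 0)
    (v := fun σ => if ¬ σ.SameCycle j k then cycleProd B σ j * (T σ : Quaternion ℝ) else 0)
    (fun σ => by rw [sign_reverseCycle]) ?_ ?_
  · rw [hmerge, hsplit, Finset.sum_neg_distrib, neg_add_eq_zero, Finset.sum_filter,
      Finset.sum_filter]
    refine Eq.trans (Finset.sum_congr rfl fun σ _ => ?_) (havg.trans
      (Finset.sum_congr rfl fun σ _ => ?_))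
    · split_ifs <;> simp
    · split_ifs <;> simp
  · intro σ
    simp only [sameCycle_reverseCycle]
    by_cases hσ : σ.SameCycle j k
    · simp [hσ]
    · rw [if_pos hσ, if_pos hσ,
        cycleProd_reverseCycle_of_not_sameCycle B (fun h' => hσ h'.symm)]
      congr 2
      refine cycleReProd_congr (fun m => by simp only [sameCycle_reverseCycle])
        (fun m x _ => sameCycle_reverseCycle k m x) fun m hm => ?_
      rw [cycleProd_reverseCycle_of_not_sameCycle B hm.2]
  · intro σ
    simp only [sameCycle_reverseCycle]
    by_cases hσ : σ.SameCycle j k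
    · simp [hσ]
    · rw [if_pos hσ, if_pos hσ]
      refine cycleProd_reverseCycle_self fun x y hx hy => hB x y ?_ ?_
      · rintro rfl; exact hσ hx.symm
      · rintro rfl; exact hσ hy.symm

end EqualRows

/-! ### Expansion along a row and Cramer's rule -/

section Cramer

variable {n : ℕ}

/-- The row determinant `rowDet j` is left linear in the `j`-th row, because the entry of that row
is the leftmost factor of every summand. -/
theorem exists_rowDet_updateRow_eq_sum {R : Type*} [Ring R] (j : Fin n)
    (A : Matrix (Fin n) (Fin n) R) :
    ∃ c : Perm (Fin n) → R, ∀ v : Fin n → R,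
      rowDet j (A.updateRow j v) = ∑ σ : Perm (Fin n), v (σ j) * c σ := by
  refine ⟨fun σ => ((List.range (Function.minimalPeriod σ j - 1)).map
      (fun m => A ((σ ^ (m + 1)) j) ((σ ^ (m + 2)) j))).prod *
      (((sign σ : ℤ) : R) * ((List.finRange n).map (fun k =>
      if ¬ σ.SameCycle j k ∧ ∀ m, σ.SameCycle k m → k ≤ m
        then cycleProd A σ k else 1)).prod), fun v => ?_⟩
  refine Finset.sum_congr rfl fun σ _ => ?_
  have hpos : 0 < Function.minimalPeriod σ j :=
    Function.minimalPeriod_pos_of_mem_periodicPts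
      (Function.Injective.mem_periodicPts σ.injective j)
  have hfirst : cycleProd (A.updateRow j v) σ j = v (σ j) *
      ((List.range (Function.minimalPeriod σ j - 1)).map
        (fun m => A ((σ ^ (m + 1)) j) ((σ ^ (m + 2)) j))).prod := by
    rw [cycleProd_eq_prod_range]
    obtain ⟨l, hl⟩ := Nat.exists_eq_succ_of_ne_zero hpos.ne'
    rw [hl, Nat.succ_eq_add_one, List.prod_range_succ', Nat.add_sub_cancel]
    congr 1
    · simp
    · congr 1
      refine List.map_congr_left fun m hm => ?_
      have hm : m < l := by simpa using hm
      rw [Matrix.updateRow_ne]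
      intro h'
      have := Function.IsPeriodicPt.minimalPeriod_le (f := σ) (x := j) (n := m + 1) (by omega)
        (by rwa [← Equiv.Perm.iterate_eq_pow] at h')
      omega
  rw [prod_map_cycleLeaders, hfirst, ← mul_assoc, ← mul_assoc, (Int.cast_commute _ (v (σ j))).eq,
    mul_assoc, mul_assoc, ← mul_assoc _ (List.prod _) (List.prod _),
    (Int.cast_commute _ (List.prod _)).eq, mul_assoc]
  congr 5
  funext k
  split_ifs with hk
  · refine cycleProd_congr (fun _ _ => rfl) fun x y hx _ => ?_
    rw [Matrix.updateRow_ne]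
    rintro rfl
    exact hk.1 hx.symm
  · rfl

/-- Replacing the `j`-th row of a Hermitian matrix by a left combination of its rows multiplies
the determinant by the coefficient of the `j`-th row, from the left. -/
theorem rowDet_updateRow_vecMul {A : Matrix (Fin n) (Fin n) (Quaternion ℝ)} (hA : A.IsHermitian)
    (j : Fin n) (w : Fin n → Quaternion ℝ) :
    rowDet j (A.updateRow j (Matrix.vecMul w A)) = w j * rowDet j A := by
  obtain ⟨c, hc⟩ := exists_rowDet_updateRow_eq_sum j A
  have hsum : rowDet j (A.updateRow j (Matrix.vecMul w A)) =
      ∑ k, w k * rowDet j (A.updateRow j (A k)) := by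
    simp only [hc, Matrix.vecMul, dotProduct, Finset.mul_sum, Finset.sum_mul, mul_assoc]
    rw [Finset.sum_comm]
  rw [hsum, Finset.sum_eq_single j, Matrix.updateRow_eq_self]
  · intro k _ hk
    rw [rowDet_eq_zero_of_row_eq (k := k) _ hk.symm, mul_zero]
    · simp [Matrix.updateRow_ne hk]
    · intro x y hx hy
      rw [Matrix.updateRow_ne hx, Matrix.updateRow_ne hy, hA.apply]
  · simp

theorem colDet_eq_rowDet {A : Matrix (Fin n) (Fin n) (Quaternion ℝ)} (hA : A.IsHermitian)
    (i : Fin n) : colDet i A = rowDet i A := by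
  nth_rewrite 1 [← hA.eq]
  rw [← star_rowDet, rowDet_eq_coe_sum_cycleReProd hA, Quaternion.star_coe]

theorem colDet_updateCol_mulVec {A : Matrix (Fin n) (Fin n) (Quaternion ℝ)} (hA : A.IsHermitian)
    (j : Fin n) (x : Fin n → Quaternion ℝ) :
    colDet j (A.updateCol j (A.mulVec x)) = x j * rowDet j A := by
  have h := congrArg star (rowDet_updateRow_vecMul hA j (star x))
  have hy : Matrix.vecMul (star x) A = star (A.mulVec x) := by rw [Matrix.star_mulVec, hA.eq]
  have hreal : star (rowDet j A) = rowDet j A := by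
    rw [rowDet_eq_coe_sum_cycleReProd hA, Quaternion.star_coe]
  rwa [hy, star_rowDet, ← Matrix.updateCol_conjTranspose, star_star, hA.eq, star_mul,
    Pi.star_apply, star_star, hreal, rowDet_eq_coe_sum_cycleReProd hA, Quaternion.coe_commutes,
    ← rowDet_eq_coe_sum_cycleReProd hA j] at h

theorem theorem9p3 {n : ℕ} [NeZero n] (A : Matrix (Fin n) (Fin n) (Quaternion ℝ))
    (hA : A.IsHermitian) :
    -- `det A` is well defined and real
    ((∃ d : ℝ, hermitianDet A = (d : Quaternion ℝ)) ∧
      ∀ i : Fin n, rowDet i A = hermitianDet A ∧ colDet i A = hermitianDet A) ∧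
    -- Cramer's rule for the right system `A x = y`
    (hermitianDet A ≠ 0 → ∀ y : Fin n → Quaternion ℝ,
      (∃! x : Fin n → Quaternion ℝ, A.mulVec x = y) ∧
      ∀ x : Fin n → Quaternion ℝ, A.mulVec x = y →
        ∀ j : Fin n, x j = colDet j (A.updateCol j y) / hermitianDet A) := by
  have hrow : ∀ i, rowDet i A = hermitianDet A := fun i => by
    rw [hermitianDet, rowDet_eq_coe_sum_cycleReProd hA, rowDet_eq_coe_sum_cycleReProd hA]
  refine ⟨⟨⟨_, rowDet_eq_coe_sum_cycleReProd hA 0⟩, fun i =>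
    ⟨hrow i, (colDet_eq_rowDet hA i).trans (hrow i)⟩⟩, fun hdet => ?_⟩
  have hformula : ∀ x j, x j = colDet j (A.updateCol j (A.mulVec x)) / hermitianDet A := by
    intro x j
    rw [colDet_updateCol_mulVec hA, hrow, mul_div_cancel_right₀ _ hdet]
  let f : (Fin n → Quaternion ℝ) →ₗ[ℝ] (Fin n → Quaternion ℝ) :=
    { toFun := A.mulVec
      map_add' := Matrix.mulVec_add A
      map_smul' := fun c x => Matrix.mulVec_smul A c x }
  have hinj : Function.Injective f := fun x z (hxz : A.mulVec x = A.mulVec z) =>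
    funext fun j => by rw [hformula x, hformula z, hxz]
  intro y
  obtain ⟨x, hx⟩ := LinearMap.injective_iff_surjective.1 hinj y
  refine ⟨⟨x, hx, fun z hz => hinj (hz.trans hx.symm)⟩, ?_⟩
  rintro x rfl
  exact hformula x

end Cramer
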